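/- Let $p$ be a prime and let $\omega$ be a non-principal ultrafilter on $\mathbb{N}$. Let $\mathbf{F}$ be the ultraproduct of the spaces $\mathbb{F}_p^i$, $i\in\mathbb{N}$, along $\omega$: sequences $(x_i)$ with $x_i\in\mathbb{F}_p^i$, where two sequences that agree for $\omega$-almost all $i$ are identified. The class of $(x_i)$ is written $\lim_{i\to\omega}x_i$, and $\mathbf{F}$ is an $\mathbb{F}_p$-vector space under the operations induced coordinatewise. Let $\mu$ be the (complete) Loeb probability measure on $\mathbf{F}$ that comes from the normalized counting measures on the spaces $\mathbb{F}_p^i$. For a finite set $\mathcal{L}\subseteq\mathbb{F}_p^k$ of linear forms $L=(\lambda_1,\dots,\lambda_k)$, acting by $L(x_1,\dots,x_k)=\lambda_1x_1+\dots+\lambda_kx_k$, put \[ t_{\mathcal L}(g)=\mathop{\mathbf{E}}_{x_1,\dots,x_k\in\mathbb{F}_p^n}\Bigl[\prod_{L\in\mathcal L}g(L(x_1,\dots,x_k))\Bigr], \qquad t_{\mathcal L}(\mathbf f)=\int_{\mathbf F}\cdots\int_{\mathbf F}\prod_{L\in\mathcal L}\mathbf f(L(\mathbf x_1,\dots,\mathbf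 x_k))\,d\mu(\mathbf x_1)\cdots d\mu(\mathbf x_k) \] for $g:\mathbb{F}_p^n\to\mathbb{R}$ and for bounded $\mu$-measurable $\mathbf f:\mathbf F\to\mathbb R$. The system $\mathcal L$ is affine if $k\ge 1$ and $\lambda_1=1$ for all $L\in\mathcal L$. A sequence of functions $f_j:\mathbb{F}_p^{n_j}\to\{0,1\}$ $t$-converges to a bounded $\mu$-measurable function $\mathbf f$ if $\lim_{j\to\infty}t_{\mathcal L}(f_j)=t_{\mathcal L}(\mathbf f)$ for every finite affine system $\mathcal L$ of linear forms, in any number $k \ge 1$ of variables. **Lemma.** Let $\mathbf f:\mathbf F\to\{0,1\}$ be a function that is $\mu$-measurable, or that is of the form $\mathbf f(\lim_{i\to\omega}x_i)=\mathrm{st}(\lim_{i\to\omega}g_i(x_i))$ for some sequence of functions $g_i:\mathbb{F}_p^i\to\mathbb{R}$, where $\mathrm{st}$ is the standard part of a bounded hyperreal and all the hyperreals $\lim_{i\to\omega}g_i(x_i)$ are bounded. Then $\mathbf f$ is $\mu$-measurable, and there are integers $n_j\ge 1$ and functions $f_j:\mathbb{F}_p^{n_j}\to\{0,1\}$, $j\in\mathbb{N}$,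 such that the sequence $(f_j)$ $t$-converges to $\mathbf f$. -/

import Mathlib

open Filter MeasureTheory
open scoped ENNReal BigOperators

namespace UltraLimit

noncomputable section

/-- The vector space `𝔽_p^n`. -/
abbrev Vec (p n : ℕ) : Type := Fin n → ZMod p

/-- The ultraproduct `𝐅` of the spaces `𝔽_p^i` with respect to the ultrafilter `ω`. -/
def UltraSpace (ω : Ultrafilter ℕ) (p : ℕ) : Type :=
  Filter.Product (ω : Filter ℕ) (fun i : ℕ => Vec p i)

variable {ω : Ultrafilter ℕ} {p : ℕ}

/-- The class `lim_{i → ω} a_i` of a sequence of points `a_i ∈ 𝔽_p^i`. -/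
def ulim (ω : Ultrafilter ℕ) {p : ℕ} (a : ∀ i : ℕ, Vec p i) : UltraSpace ω p :=
  Quotient.mk (productSetoid (ω : Filter ℕ) (fun i : ℕ => Vec p i)) a

theorem ulim_eq_iff (a b : ∀ i : ℕ, Vec p i) :
    ulim ω a = ulim ω b ↔ ∀ᶠ i in (ω : Filter ℕ), a i = b i :=
  Quotient.eq (r := productSetoid (ω : Filter ℕ) (fun i : ℕ => Vec p i))

theorem ulim_surjective :
    Function.Surjective (ulim ω : (∀ i : ℕ, Vec p i) → UltraSpace ω p) :=
  Quotient.mk_surjective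

/-! The operations on `𝐅` are induced by the coordinatewise operations on sequences. -/

instance : Zero (UltraSpace ω p) := ⟨ulim ω 0⟩

instance : Add (UltraSpace ω p) :=
  ⟨Quotient.map₂ (· + ·) fun _ _ h _ _ h' => by
    filter_upwards [h, h'] with i e e'
    simp [e, e']⟩

instance : Neg (UltraSpace ω p) :=
  ⟨Quotient.map (- ·) fun _ _ h => by
    filter_upwards [h] with i e
    simp [e]⟩

instance : Sub (UltraSpace ω p) :=
  ⟨Quotient.map₂ (· - ·) fun _ _ h _ _ h' => by
    filter_upwards [h, h'] with i e e'
    simp [e, e']⟩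

instance : SMul ℕ (UltraSpace ω p) :=
  ⟨fun c => Quotient.map (c • ·) fun _ _ h => by
    filter_upwards [h] with i e
    simp [e]⟩

instance : SMul ℤ (UltraSpace ω p) :=
  ⟨fun c => Quotient.map (c • ·) fun _ _ h => by
    filter_upwards [h] with i e
    simp [e]⟩

instance : SMul (ZMod p) (UltraSpace ω p) :=
  ⟨fun c => Quotient.map (c • ·) fun _ _ h => by
    filter_upwards [h] with i e
    simp [e]⟩

theorem ulim_add (a b : ∀ i : ℕ, Vec p i) : ulim ω (a + b) = ulim ω a + ulim ω b := rfl

theorem ulim_smul (c : ZMod p) (a : ∀ i : ℕ, Vec p i) : ulim ω (c • a) = c • ulim ω a := rfl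

instance : AddCommGroup (UltraSpace ω p) :=
  Function.Surjective.addCommGroup (ulim ω) ulim_surjective rfl (fun _ _ => rfl)
    (fun _ => rfl) (fun _ _ => rfl) (fun _ _ => rfl) (fun _ _ => rfl)

/-- `lim_{i → ω}` as an additive homomorphism. -/
def ulimHom (ω : Ultrafilter ℕ) (p : ℕ) : (∀ i : ℕ, Vec p i) →+ UltraSpace ω p where
  toFun := ulim ω
  map_zero' := rfl
  map_add' _ _ := rfl

instance : Module (ZMod p) (UltraSpace ω p) :=
  Function.Surjective.module (ZMod p) (ulimHom ω p) ulim_surjective (fun _ _ => rfl)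

/-- The hyperreal numbers: the ultrapower of `ℝ` with respect to `ω`. -/
abbrev HyperR (ω : Ultrafilter ℕ) : Type := Germ (ω : Filter ℕ) ℝ

/-- The hyperreal `lim_{i → ω} r_i`. -/
def hlim (ω : Ultrafilter ℕ) (r : ℕ → ℝ) : HyperR ω := (r : Germ (ω : Filter ℕ) ℝ)

/-- A hyperreal is bounded if its absolute value is below a standard real. -/
def IsBddHyper (a : HyperR ω) : Prop := ∃ C : ℝ, |a| < hlim ω fun _ => C

/-- The standard part of a hyperreal (only meaningful for bounded ones). -/
def st (a : HyperR ω) : ℝ := ArchimedeanClass.stdPart a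

/-- `f = st (lim_{i → ω} g_i)` for some sequence of functions `g_i : 𝔽_p^i → ℝ`.
As `f` is real valued, the hyperreals `lim_{i → ω} g_i (x_i)` have to be bounded. -/
def IsFunctionLimit (f : UltraSpace ω p → ℝ) : Prop :=
  ∃ g : ∀ i : ℕ, Vec p i → ℝ, ∀ x : ∀ i : ℕ, Vec p i,
    IsBddHyper (hlim ω fun i => g i (x i)) ∧ f (ulim ω x) = st (hlim ω fun i => g i (x i))

/-- The internal set `lim_{i → ω} H_i`. Requiring `a_i ∈ H_i` only for `ω`-almost all `i` makes the
set depend only on the class of `(H_i)` modulo `ω`, also when some of the `H_i` are empty. -/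
def internalSet (ω : Ultrafilter ℕ) {p : ℕ} (H : ∀ i : ℕ, Set (Vec p i)) :
    Set (UltraSpace ω p) :=
  {x | ∃ a : ∀ i : ℕ, Vec p i, (∀ᶠ i in (ω : Filter ℕ), a i ∈ H i) ∧ ulim ω a = x}

/-- `st (lim_{i → ω} μ_i (H_i))` with `μ_i` the normalized counting measure on `𝔽_p^i`. -/
def internalMass (ω : Ultrafilter ℕ) {p : ℕ} (H : ∀ i : ℕ, Set (Vec p i)) : ℝ≥0∞ :=
  ENNReal.ofReal (st (hlim ω fun i => ((H i).ncard : ℝ) / (Nat.card (Vec p i) : ℝ)))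

/-- The Loeb premeasure: `lim_{i → ω} H_i ↦ st (lim_{i → ω} μ_i (H_i))` on internal sets,
`∞` on all other sets. -/
def loebPre (ω : Ultrafilter ℕ) (p : ℕ) (S : Set (UltraSpace ω p)) : ℝ≥0∞ :=
  ⨅ (H : ∀ i : ℕ, Set (Vec p i)) (_ : S = internalSet ω H), internalMass ω H

theorem loebPre_empty (ω : Ultrafilter ℕ) (p : ℕ) : loebPre ω p ∅ = 0 := by
  refine le_antisymm (iInf₂_le_of_le (fun _ => ∅) ?_ ?_) (zero_le)
  · ext x
    simp [internalSet, ω.neBot.ne]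
  · have h : (hlim ω fun _ => (0 : ℝ)) = (0 : HyperR ω) := rfl
    simp [internalMass, st, h]

/-- The Loeb outer measure: the infimum of `∑ st (lim μ_i (H^n_i))` over countable covers by
internal sets `lim H^n_i`. -/
def loebOuter (ω : Ultrafilter ℕ) (p : ℕ) : OuterMeasure (UltraSpace ω p) :=
  OuterMeasure.ofFunction (loebPre ω p) (loebPre_empty ω p)

/-- The (complete) Loeb `σ`-algebra, through Carathéodory's construction. -/
instance instMeasurableSpaceUltraSpace : MeasurableSpace (UltraSpace ω p) :=
  (loebOuter ω p).caratheodory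

/-- The Loeb measure on `𝐅`. -/
def loebMeasure (ω : Ultrafilter ℕ) (p : ℕ) : Measure (UltraSpace ω p) :=
  (loebOuter ω p).toMeasure le_rfl

/-- The class `𝓕` of bounded Loeb measurable functions `𝐅 → ℝ`. -/
def IsBddMeas (f : UltraSpace ω p → ℝ) : Prop :=
  Measurable f ∧ ∃ C : ℝ, ∀ x, |f x| ≤ C

/-- The iterated integral `∫ ⋯ ∫ g(x_1, …, x_k) dx_1 ⋯ dx_k` with respect to the Loeb measure. -/
def iterInt (ω : Ultrafilter ℕ) (p : ℕ) : (k : ℕ) → ((Fin k → UltraSpace ω p) → ℝ) → ℝ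
  | 0, g => g Fin.elim0
  | k + 1, g => ∫ y, iterInt ω p k
      (fun x => g (Fin.snoc (α := fun _ => UltraSpace ω p) x y)) ∂(loebMeasure ω p)

/-- `L(x_1, …, x_k) = λ_1 x_1 + ⋯ + λ_k x_k` for a linear form `L = (λ_1, …, λ_k) ∈ 𝔽_p^k`. -/
def evalForm {V : Type*} [AddCommGroup V] [Module (ZMod p) V] {k : ℕ} (L : Vec p k)
    (x : Fin k → V) : V :=
  ∑ j, L j • x j

/-- A system of linear forms in `k + 1` variables is affine if all first coefficients are `1`. -/
def IsAffineSystem {k : ℕ} (𝓛 : Finset (Vec p (k + 1))) : Prop := ∀ L ∈ 𝓛, L 0 = 1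

/-- `t_𝓛(f) = 𝔼_{x_1, …, x_k} ∏_{L ∈ 𝓛} f(L(x_1, …, x_k))` for `f : 𝔽_p^n → ℝ`. -/
def tFun [NeZero p] {k n : ℕ} (𝓛 : Finset (Vec p k)) (f : Vec p n → ℝ) : ℝ :=
  𝔼 x : Fin k → Vec p n, ∏ L ∈ 𝓛, f (evalForm L x)

/-- `t_𝓛(f) = ∫ ⋯ ∫ ∏_{L ∈ 𝓛} f(L(x_1, …, x_k)) dx_1 ⋯ dx_k` for `f : 𝐅 → ℝ`. -/
def tLim {k : ℕ} (𝓛 : Finset (Vec p k)) (f : UltraSpace ω p → ℝ) : ℝ :=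
  iterInt ω p k fun x => ∏ L ∈ 𝓛, f (evalForm L x)

/-- The sequence `f_j : 𝔽_p^{n_j} → ℝ` `t`-converges to `F : 𝐅 → ℝ`: the function `F` is in `𝓕`,
and `t_𝓛(f_j) → t_𝓛(F)` for every finite affine system `𝓛` of linear forms. -/
def TConvergesTo [NeZero p] {n : ℕ → ℕ} (f : ∀ j : ℕ, Vec p (n j) → ℝ)
    (F : UltraSpace ω p → ℝ) : Prop :=
  IsBddMeas F ∧ ∀ (k : ℕ) (𝓛 : Finset (Vec p (k + 1))), IsAffineSystem 𝓛 →
    Tendsto (fun j => tFun 𝓛 (f j)) atTop (nhds (tLim 𝓛 F))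

end

end UltraLimit

open UltraLimit

open UltraLimit

namespace UltraLimit

variable {ω : Ultrafilter ℕ} {p : ℕ}

/-! Almost everywhere, `f` is the indicator of one internal set `lim H_i`. For measurable `f` this
is the regularity of Loeb measure (`exists_internalSet_ae_eq`), a consequence of countable
saturation; for a function limit one takes `H_i = {g_i > 1/2}`. Averages of [0,1]-valued functions
over the finite spaces converge along `ω` to iterated integrals of their ultralimit
(`IsPointwiseLimit.tendsto_tFun`), so the indicators of the `H_i` have the right averages in the
limit. Replacing `f` by that indicator leaves `tLim` unchanged for affine systems, because
translations preserve null sets (`tLim_congr_ae`). There are only countably many systems, so a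
diagonal choice of indices turns convergence along `ω` into convergence of a sequence
(`exists_subseq_tendsto`). -/

/-! ### Standard parts as limits along `ω` -/

/-- The embedding of the reals into the hyperreals. -/
noncomputable def hyperConst (ω : Ultrafilter ℕ) : ℝ →+*o HyperR ω where
  toFun r := hlim ω fun _ => r
  map_one' := rfl
  map_zero' := rfl
  map_mul' _ _ := rfl
  map_add' _ _ := rfl
  monotone' _ _ h := Germ.coe_le.2 (Eventually.of_forall fun _ => h)

theorem st_hlim_eq_of_tendsto {r : ℕ → ℝ} {a : ℝ} (h : Tendsto r (ω : Filter ℕ) (nhds a)) :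
    st (hlim ω r) = a := by
  refine ArchimedeanClass.stdPart_eq (hyperConst ω) (fun s hs => ?_) fun s hs => ?_
  · exact Germ.coe_le.2 ((h.eventually (lt_mem_nhds hs)).mono fun _ => le_of_lt)
  · exact Germ.coe_le.2 ((h.eventually (gt_mem_nhds hs)).mono fun _ => le_of_lt)

theorem tendsto_st_hlim {r : ℕ → ℝ} {C : ℝ} (h : ∀ᶠ i in (ω : Filter ℕ), |r i| ≤ C) :
    Tendsto r (ω : Filter ℕ) (nhds (st (hlim ω r))) := by
  obtain ⟨a, -, ha⟩ := (isCompact_Icc (a := -C) (b := C)).ultrafilter_le_nhds (ω.map r)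
    (le_principal_iff.2 (h.mono fun i hi => abs_le.1 hi))
  have ha : Tendsto r (ω : Filter ℕ) (nhds a) := ha
  rwa [st_hlim_eq_of_tendsto ha]

theorem IsBddHyper.tendsto {r : ℕ → ℝ} (h : IsBddHyper (hlim ω r)) :
    Tendsto r (ω : Filter ℕ) (nhds (st (hlim ω r))) := by
  obtain ⟨C, hC⟩ := h
  refine tendsto_st_hlim (C := C) ?_
  have h1 : hlim ω r ≤ hlim ω fun _ => C := (le_abs_self _).trans hC.le
  have h2 : (hlim ω fun i => - r i) ≤ hlim ω fun _ => C := (neg_le_abs (hlim ω r)).trans hC.le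
  filter_upwards [Germ.coe_le.1 h1, Germ.coe_le.1 h2] with i a b
  exact abs_le'.2 ⟨a, b⟩

/-! ### Saturation and internal sets -/

/-- Countable saturation: countably many conditions, any finitely many of which can be met
simultaneously in almost all coordinates, can be met simultaneously by one sequence. -/
theorem countable_saturation (hω : ∀ s : Set ℕ, s.Finite → s ∉ ω) {X : ℕ → Type*}
    [∀ i, Nonempty (X i)] (P : ℕ → ∀ i, X i → Prop)
    (h : ∀ n, ∀ᶠ i in (ω : Filter ℕ), ∃ x, ∀ m < n, P m i x) :
    ∃ x : ∀ i, X i, ∀ n, ∀ᶠ i in (ω : Filter ℕ), P n i (x i) := by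
  classical
  have key : ∀ i, ∃ x : X i, ∀ n ≤ i, (∃ y, ∀ m < n, P m i y) → ∀ m < n, P m i x := by
    intro i
    by_cases hi : ∃ n ≤ i, ∃ y, ∀ m < n, P m i y
    -- `N` is the largest number of initial conditions solvable together in coordinate `i`. The cap
    -- at `i` makes it exist and is harmless, since `ω` contains no finite set.
    · let N := Nat.findGreatest (fun n => ∃ y, ∀ m < n, P m i y) i
      obtain ⟨n, hn, hy⟩ := hi
      obtain ⟨y, hy⟩ : ∃ y, ∀ m < N, P m i y :=
        Nat.findGreatest_spec (P := fun n => ∃ y, ∀ m < n, P m i y) hn hy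
      exact ⟨y, fun n hn hy' m hm => hy m (hm.trans_le (Nat.le_findGreatest hn hy'))⟩
    · exact ⟨Classical.arbitrary _, fun n hn hy => (hi ⟨n, hn, hy⟩).elim⟩
  choose x hx using key
  refine ⟨x, fun n => ?_⟩
  have hlarge : ∀ᶠ i in (ω : Filter ℕ), n + 1 ≤ i := by
    have := Ultrafilter.compl_mem_iff_notMem.2 (hω (Set.Iio (n + 1)) (Set.finite_Iio _))
    filter_upwards [this] with i hi
    simpa using hi
  filter_upwards [hlarge, h (n + 1)] with i h1 h2
  exact hx i _ h1 h2 n n.lt_succ_self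

theorem ulim_mem_internalSet {H : ∀ i, Set (Vec p i)} {a : ∀ i, Vec p i} :
    ulim ω a ∈ internalSet ω H ↔ ∀ᶠ i in (ω : Filter ℕ), a i ∈ H i := by
  constructor
  · rintro ⟨b, hb, h⟩
    filter_upwards [hb, (ulim_eq_iff _ _).1 h] with i h1 h2
    rwa [← h2]
  · exact fun h => ⟨a, h, rfl⟩

theorem internalSet_subset_iff {H K : ∀ i, Set (Vec p i)} :
    internalSet ω H ⊆ internalSet ω K ↔ ∀ᶠ i in (ω : Filter ℕ), H i ⊆ K i := by
  constructor
  · intro h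
    by_contra hc
    replace hc := Ultrafilter.eventually_not.2 hc
    classical
    -- A point of `H i \ K i` wherever there is one; the value 0 is used only on an `ω`-null set of
    -- indices.
    let a : ∀ i, Vec p i := fun i => if hi : ¬ H i ⊆ K i then (Set.not_subset.1 hi).choose else 0
    have ha : ∀ᶠ i in (ω : Filter ℕ), a i ∈ H i ∧ a i ∉ K i := by
      filter_upwards [hc] with i hi
      simp only [a, dif_pos hi]
      exact (Set.not_subset.1 hi).choose_spec
    have := ulim_mem_internalSet.1 (h (ulim_mem_internalSet.2 (ha.mono fun _ => And.left)))
    obtain ⟨i, h1, h2⟩ := (ha.and this).exists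
    exact h1.2 h2
  · intro h x hx
    obtain ⟨a, rfl⟩ := ulim_surjective x
    rw [ulim_mem_internalSet] at *
    filter_upwards [h, hx] with i h1 h2 using h1 h2

theorem internalSet_inter (H K : ∀ i, Set (Vec p i)) :
    internalSet ω (fun i => H i ∩ K i) = internalSet ω H ∩ internalSet ω K := by
  ext x
  obtain ⟨a, rfl⟩ := ulim_surjective x
  simp [ulim_mem_internalSet, eventually_and]

/-- This needs an ultrafilter: exactly one of a set of indices and its complement is large. -/
theorem internalSet_compl (H : ∀ i, Set (Vec p i)) :
    internalSet ω (fun i => (H i)ᶜ) = (internalSet ω H)ᶜ := by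
  ext x
  obtain ⟨a, rfl⟩ := ulim_surjective x
  simp only [Set.mem_compl_iff, ulim_mem_internalSet, Ultrafilter.eventually_not]

theorem internalSet_diff (H K : ∀ i, Set (Vec p i)) :
    internalSet ω (fun i => H i \ K i) = internalSet ω H \ internalSet ω K := by
  simp only [Set.sdiff_eq, internalSet_inter, internalSet_compl]

/-- A countable cover of an internal set by internal sets has a finite subcover. -/
theorem exists_finite_subcover (hω : ∀ s : Set ℕ, s.Finite → s ∉ ω) (H : ∀ i, Set (Vec p i))
    (K : ℕ → ∀ i, Set (Vec p i)) (h : internalSet ω H ⊆ ⋃ n, internalSet ω (K n)) :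
    ∃ N, ∀ᶠ i in (ω : Filter ℕ), H i ⊆ ⋃ n < N, K n i := by
  by_contra! hc
  -- If no finite union suffices, saturation yields a point of `lim H` outside every `lim K n`.
  obtain ⟨x, hx⟩ := countable_saturation hω (X := fun i => Vec p i)
    (fun n i x => x ∈ H i ∧ x ∉ K n i) fun n => by
      rcases n with _ | n
      · simp
      filter_upwards [hc (n + 1)] with i hi
      obtain ⟨x, hx, hx'⟩ := Set.not_subset.1 hi
      exact ⟨x, fun m hm => ⟨hx, fun h' => hx' (Set.mem_biUnion hm h')⟩⟩
  have h1 := h (ulim_mem_internalSet.2 ((hx 0).mono fun _ => And.left))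
  obtain ⟨n, hn⟩ := Set.mem_iUnion.1 h1
  obtain ⟨i, h1, h2⟩ := ((hx n).and (ulim_mem_internalSet.1 hn)).exists
  exact h1.2 h2

/-! ### Densities and the mass of internal sets -/

/-- The density of a subset of `𝔽_p^n`. -/
noncomputable def density {n : ℕ} (H : Set (Vec p n)) : ℝ := (H.ncard : ℝ) / (Nat.card (Vec p n) : ℝ)

theorem density_nonneg {n : ℕ} (H : Set (Vec p n)) : 0 ≤ density H := by
  unfold density; positivity

theorem density_mono [NeZero p] {n : ℕ} {H K : Set (Vec p n)} (h : H ⊆ K) :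
    density H ≤ density K := by
  unfold density
  have := Set.ncard_le_ncard h (Set.toFinite K)
  gcongr

theorem density_union_le {n : ℕ} (H K : Set (Vec p n)) :
    density (H ∪ K) ≤ density H + density K := by
  unfold density
  rw [← add_div]
  have := Set.ncard_union_le H K
  gcongr
  exact_mod_cast this

theorem density_inter_add_diff [NeZero p] {n : ℕ} (H K : Set (Vec p n)) :
    density (H ∩ K) + density (H \ K) = density H := by
  unfold density
  rw [← add_div, ← Nat.cast_add, Set.ncard_inter_add_ncard_sdiff_eq_ncard _ _ (Set.toFinite H)]

theorem density_univ [NeZero p] (n : ℕ) : density (Set.univ : Set (Vec p n)) = 1 := by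
  rw [density, Set.ncard_univ, div_self]
  exact_mod_cast Nat.card_pos.ne'

theorem density_le_one [NeZero p] {n : ℕ} (H : Set (Vec p n)) : density H ≤ 1 :=
  (density_mono (Set.subset_univ H)).trans (density_univ n).le

theorem density_preimage_add_right {n : ℕ} (H : Set (Vec p n)) (c : Vec p n) :
    density ((· + c) ⁻¹' H) = density H := by
  unfold density
  rw [Set.ncard_preimage_of_injective_subset_range (add_left_injective c)]
  intro x _
  exact ⟨x - c, sub_add_cancel x c⟩

theorem tendsto_density [NeZero p] (H : ∀ i, Set (Vec p i)) :
    Tendsto (fun i => density (H i)) (ω : Filter ℕ) (nhds (internalMass ω H).toReal) := by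
  have h : Tendsto (fun i => density (H i)) (ω : Filter ℕ)
      (nhds (st (hlim ω fun i => density (H i)))) :=
    tendsto_st_hlim (C := 1) (Eventually.of_forall fun i => by
      rw [abs_of_nonneg (density_nonneg _)]; exact density_le_one _)
  have h0 : 0 ≤ st (hlim ω fun i => density (H i)) :=
    ge_of_tendsto' h fun i => density_nonneg _
  rw [internalMass]
  change Tendsto _ _ (nhds (ENNReal.ofReal (st (hlim ω fun i => density (H i)))).toReal)
  rwa [ENNReal.toReal_ofReal h0]

theorem internalMass_ne_top (H : ∀ i, Set (Vec p i)) : internalMass ω H ≠ ∞ :=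
  ENNReal.ofReal_ne_top

theorem internalMass_mono [NeZero p] {H K : ∀ i, Set (Vec p i)}
    (h : ∀ᶠ i in (ω : Filter ℕ), H i ⊆ K i) : internalMass ω H ≤ internalMass ω K := by
  rw [← ENNReal.toReal_le_toReal (internalMass_ne_top H) (internalMass_ne_top K)]
  exact le_of_tendsto_of_tendsto (tendsto_density H) (tendsto_density K)
    (h.mono fun i hi => density_mono hi)

theorem internalMass_union_le [NeZero p] (H K : ∀ i, Set (Vec p i)) :
    internalMass ω (fun i => H i ∪ K i) ≤ internalMass ω H + internalMass ω K := by
  rw [← ENNReal.toReal_le_toReal (internalMass_ne_top _)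
    (ENNReal.add_ne_top.2 ⟨internalMass_ne_top H, internalMass_ne_top K⟩),
    ENNReal.toReal_add (internalMass_ne_top H) (internalMass_ne_top K)]
  exact le_of_tendsto_of_tendsto' (tendsto_density _)
    ((tendsto_density H).add (tendsto_density K)) fun i => density_union_le _ _

theorem internalMass_inter_add_diff [NeZero p] (H K : ∀ i, Set (Vec p i)) :
    internalMass ω (fun i => H i ∩ K i) + internalMass ω (fun i => H i \ K i)
      = internalMass ω H := by
  rw [← ENNReal.toReal_eq_toReal_iff' (ENNReal.add_ne_top.2
    ⟨internalMass_ne_top _, internalMass_ne_top _⟩) (internalMass_ne_top H),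
    ENNReal.toReal_add (internalMass_ne_top _) (internalMass_ne_top _)]
  refine tendsto_nhds_unique ((tendsto_density _).add (tendsto_density _)) ?_
  simpa only [density_inter_add_diff] using tendsto_density (ω := ω) H

theorem internalMass_empty [NeZero p] : internalMass ω (fun i => (∅ : Set (Vec p i))) = 0 := by
  have h : (hlim ω fun _ => (0 : ℝ)) = (0 : HyperR ω) := rfl
  simp [internalMass, st, h]

theorem internalMass_biUnion_le [NeZero p] (N : ℕ) (K : ℕ → ∀ i, Set (Vec p i)) :
    internalMass ω (fun i => ⋃ n < N, K n i) ≤ ∑ n ∈ Finset.range N, internalMass ω (K n) := by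
  induction N with
  | zero => simp [internalMass_empty]
  | succ N ih =>
    simp only [Set.biUnion_lt_succ, Finset.sum_range_succ]
    exact (internalMass_union_le _ _).trans (by gcongr)

/-! ### Loeb measure of internal sets, null sets and translations -/

theorem loebPre_internalSet [NeZero p] (H : ∀ i, Set (Vec p i)) :
    loebPre ω p (internalSet ω H) = internalMass ω H :=
  le_antisymm (iInf₂_le_of_le H rfl le_rfl) (le_iInf₂ fun _ h =>
    internalMass_mono (internalSet_subset_iff.1 h.le))

theorem loebPre_eq_top {S : Set (UltraSpace ω p)} (h : ∀ H, S ≠ internalSet ω H) :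
    loebPre ω p S = ∞ := by
  simp [loebPre, h]

/-- Countable covers reduce to finite ones, so finite subadditivity of the mass gives the lower
bound. -/
theorem loebOuter_internalSet [NeZero p] (hω : ∀ s : Set ℕ, s.Finite → s ∉ ω)
    (H : ∀ i, Set (Vec p i)) : loebOuter ω p (internalSet ω H) = internalMass ω H := by
  refine le_antisymm ((OuterMeasure.ofFunction_le _).trans (loebPre_internalSet H).le) ?_
  rw [loebOuter, OuterMeasure.ofFunction_apply]
  refine le_iInf₂ fun t ht => ?_
  by_cases htop : ∃ n, ∀ K, t n ≠ internalSet ω K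
  · obtain ⟨n, hn⟩ := htop
    rw [ENNReal.tsum_eq_top_of_eq_top ⟨n, loebPre_eq_top hn⟩]
    exact le_top
  push Not at htop
  choose K hK using htop
  obtain rfl : t = fun n => internalSet ω (K n) := funext hK
  simp only [loebPre_internalSet]
  obtain ⟨N, hN⟩ := exists_finite_subcover hω H K ht
  exact (internalMass_mono hN).trans ((internalMass_biUnion_le N K).trans (ENNReal.sum_le_tsum _))

/-- The Carathéodory inequality need only be tested on the premeasure: on internal sets it is finite
additivity, on others the right side is ∞. -/
theorem measurableSet_internalSet [NeZero p] (H : ∀ i, Set (Vec p i)) :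
    MeasurableSet (internalSet ω H) := by
  refine OuterMeasure.ofFunction_caratheodory fun t => ?_
  by_cases ht : ∃ K, t = internalSet ω K
  · obtain ⟨K, rfl⟩ := ht
    rw [← internalSet_inter, ← internalSet_diff, loebPre_internalSet, loebPre_internalSet,
      loebPre_internalSet, internalMass_inter_add_diff]
  · rw [loebPre_eq_top (S := t) fun K hK => ht ⟨K, hK⟩]
    exact le_top

theorem loebMeasure_apply {S : Set (UltraSpace ω p)} (hS : MeasurableSet S) :
    loebMeasure ω p S = loebOuter ω p S :=
  toMeasure_apply _ _ hS

theorem loebMeasure_internalSet [NeZero p] (hω : ∀ s : Set ℕ, s.Finite → s ∉ ω)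
    (H : ∀ i, Set (Vec p i)) : loebMeasure ω p (internalSet ω H) = internalMass ω H := by
  rw [loebMeasure_apply (measurableSet_internalSet H), loebOuter_internalSet hω]

theorem internalSet_univ : internalSet ω (fun i => (Set.univ : Set (Vec p i))) = Set.univ := by
  ext x
  obtain ⟨a, rfl⟩ := ulim_surjective x
  simp [ulim_mem_internalSet]

theorem isProbabilityMeasure_loebMeasure [NeZero p] (hω : ∀ s : Set ℕ, s.Finite → s ∉ ω) :
    IsProbabilityMeasure (loebMeasure ω p) := by
  refine ⟨?_⟩
  rw [← internalSet_univ, loebMeasure_internalSet hω, internalMass]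
  change ENNReal.ofReal (st (hlim ω fun i => density (Set.univ : Set (Vec p i)))) = 1
  rw [st_hlim_eq_of_tendsto (a := 1) (by simp [density_univ]), ENNReal.ofReal_one]

/-- Completeness: sets of outer measure zero are Carathéodory measurable. Null sets can thus be
handled through the outer measure alone. -/
theorem loebMeasure_eq_zero_iff {S : Set (UltraSpace ω p)} :
    loebMeasure ω p S = 0 ↔ loebOuter ω p S = 0 := by
  refine ⟨fun h => le_antisymm ((le_toMeasure_apply _ _ S).trans h.le) zero_le, fun h => ?_⟩
  rw [loebMeasure_apply, h]
  refine (OuterMeasure.isCaratheodory_iff_le _).2 fun t => ?_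
  calc loebOuter ω p (t ∩ S) + loebOuter ω p (t \ S)
      ≤ loebOuter ω p S + loebOuter ω p t := by
        gcongr
        · exact Set.inter_subset_right
        · exact Set.sdiff_subset
    _ = loebOuter ω p t := by rw [h, zero_add]

/-- Translating an internal set translates each `K i`, which keeps its density. The inequality is
enough for moving null sets. -/
theorem loebOuter_preimage_add_right_le (c : UltraSpace ω p) (S : Set (UltraSpace ω p)) :
    loebOuter ω p ((· + c) ⁻¹' S) ≤ loebOuter ω p S := by
  obtain ⟨b, rfl⟩ := ulim_surjective c
  have key : OuterMeasure.map (· + ulim ω b) (loebOuter ω p) ≤ loebOuter ω p := by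
    refine OuterMeasure.le_ofFunction.2 fun T => ?_
    rw [OuterMeasure.map_apply]
    refine (OuterMeasure.ofFunction_le _).trans (le_iInf₂ fun K hK => ?_)
    refine (iInf₂_le (fun i => (· + b i) ⁻¹' K i) ?_).trans (le_of_eq ?_)
    · ext x
      obtain ⟨a, rfl⟩ := ulim_surjective x
      rw [hK, Set.mem_preimage, ← ulim_add, ulim_mem_internalSet, ulim_mem_internalSet]
      rfl
    · change ENNReal.ofReal (st (hlim ω fun i => density ((· + b i) ⁻¹' K i))) = _
      simp only [density_preimage_add_right]
      rfl
  exact key S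

theorem ae_add_right {P : UltraSpace ω p → Prop} (h : ∀ᵐ x ∂(loebMeasure ω p), P x)
    (c : UltraSpace ω p) : ∀ᵐ x ∂(loebMeasure ω p), P (x + c) := by
  rw [ae_iff, loebMeasure_eq_zero_iff] at *
  exact le_antisymm ((loebOuter_preimage_add_right_le c {x | ¬ P x}).trans h.le) zero_le

/-! ### Approximation of measurable sets by internal sets -/

/-- Finite unions of a near-optimal internal cover have density below `c`; saturation replaces the
countable union by a single internal set. -/
theorem exists_internalSet_superset [NeZero p] (hω : ∀ s : Set ℕ, s.Finite → s ∉ ω)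
    {S : Set (UltraSpace ω p)} {c : ℝ} (h : loebOuter ω p S < ENNReal.ofReal c) :
    ∃ U, S ⊆ internalSet ω U ∧ internalMass ω U ≤ ENNReal.ofReal c := by
  rw [loebOuter, OuterMeasure.ofFunction_apply] at h
  simp only [iInf_lt_iff] at h
  obtain ⟨t, ht, hlt⟩ := h
  have hint : ∀ n, ∃ K, t n = internalSet ω K := by
    intro n
    by_contra! hn
    rw [ENNReal.tsum_eq_top_of_eq_top ⟨n, loebPre_eq_top hn⟩] at hlt
    exact not_top_lt hlt
  choose K hK using hint
  obtain rfl : t = fun n => internalSet ω (K n) := funext hK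
  simp only [loebPre_internalSet] at hlt
  have hc : 0 < c := by
    by_contra! hc
    rw [ENNReal.ofReal_of_nonpos hc] at hlt
    exact not_lt_zero hlt
  obtain ⟨U, hU⟩ := countable_saturation hω (X := fun i => Set (Vec p i))
    (fun n i X => K n i ⊆ X ∧ density X ≤ c) fun n => by
      have h1 : (internalMass ω fun i => ⋃ m < n, K m i).toReal < c := by
        rw [← ENNReal.lt_ofReal_iff_toReal_lt (internalMass_ne_top _)]
        exact ((internalMass_biUnion_le n K).trans (ENNReal.sum_le_tsum _)).trans_lt hlt
      filter_upwards [(tendsto_density _).eventually (gt_mem_nhds h1)] with i hi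
      exact ⟨_, fun m hm => ⟨Set.subset_biUnion_of_mem (u := fun m => K m i) hm, hi.le⟩⟩
  refine ⟨U, ht.trans (Set.iUnion_subset fun n => internalSet_subset_iff.2
    ((hU n).mono fun _ => And.left)), ?_⟩
  rw [← ENNReal.ofReal_toReal (internalMass_ne_top U)]
  exact ENNReal.ofReal_le_ofReal
    (le_of_tendsto (tendsto_density U) ((hU 0).mono fun _ => And.right))

/-- Every Loeb measurable set agrees with an internal set up to a null set. -/
theorem exists_internalSet_ae_eq [NeZero p] (hω : ∀ s : Set ℕ, s.Finite → s ∉ ω)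
    {S : Set (UltraSpace ω p)} (hS : MeasurableSet S) :
    ∃ H, ∀ᵐ x ∂(loebMeasure ω p), x ∈ S ↔ x ∈ internalSet ω H := by
  have := isProbabilityMeasure_loebMeasure (p := p) hω
  have cover : ∀ T : Set (UltraSpace ω p), MeasurableSet T → ∀ n : ℕ, ∃ U,
      T ⊆ internalSet ω U ∧ (loebMeasure ω p).real (internalSet ω U)
        ≤ (loebMeasure ω p).real T + 1 / ((n : ℝ) + 1) := by
    intro T hT n
    have hpos : (0 : ℝ) < 1 / ((n : ℝ) + 1) := by positivity
    have hlt : loebOuter ω p T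
        < ENNReal.ofReal ((loebMeasure ω p).real T + 1 / ((n : ℝ) + 1)) := by
      rw [← loebMeasure_apply hT, ENNReal.lt_ofReal_iff_toReal_lt (measure_ne_top _ _)]
      exact lt_add_of_pos_right _ hpos
    obtain ⟨U, h1, h2⟩ := exists_internalSet_superset hω hlt
    refine ⟨U, h1, ?_⟩
    rw [← loebMeasure_internalSet hω] at h2
    exact ENNReal.toReal_le_of_le_ofReal (by positivity) h2
  choose U hSU hU using cover S hS
  choose W hSW hW using cover Sᶜ hS.compl
  -- The sets `lim U n` shrink to `S` from outside and the complements of `lim W n` grow to it from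
  -- inside, up to null sets. Saturation puts one internal set between them all.
  obtain ⟨H, hH⟩ := countable_saturation hω (X := fun i => Set (Vec p i))
    (fun n i X => X ⊆ U n i ∧ (W n i)ᶜ ⊆ X) fun N => by
      have h1 : ∀ m n, ∀ᶠ i in (ω : Filter ℕ), (W m i)ᶜ ⊆ U n i := fun m n => by
        rw [← internalSet_subset_iff, internalSet_compl]
        exact (Set.compl_subset_comm.1 (hSW m)).trans (hSU n)
      have h2 : ∀ᶠ i in (ω : Filter ℕ), ∀ m ∈ Finset.range N, ∀ n ∈ Finset.range N,
          (W m i)ᶜ ⊆ U n i := by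
        simp only [Finset.eventually_all]
        exact fun m _ n _ => h1 m n
      filter_upwards [h2] with i hi
      refine ⟨⋂ n < N, U n i, fun m hm => ⟨Set.biInter_subset_of_mem hm, ?_⟩⟩
      exact Set.subset_iInter₂ fun n hn => hi m (Finset.mem_range.2 hm) n (Finset.mem_range.2 hn)
  refine ⟨H, ?_⟩
  have hsub : ∀ n, {x | ¬ (x ∈ S ↔ x ∈ internalSet ω H)} ⊆
      internalSet ω (U n) ∩ internalSet ω (W n) := by
    intro n x hx
    have hHU := internalSet_subset_iff.2 ((hH n).mono fun _ => And.left)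
    have hWH := internalSet_subset_iff.2 ((hH n).mono fun _ => And.right)
    rw [internalSet_compl] at hWH
    by_cases hxS : x ∈ S
    · have hxH : x ∉ internalSet ω H := fun h => hx ⟨fun _ => h, fun _ => hxS⟩
      exact ⟨hSU n hxS, by_contra fun h => hxH (hWH h)⟩
    · have hxH : x ∈ internalSet ω H := by_contra fun h =>
        hx ⟨fun h' => (hxS h').elim, fun h' => (h h').elim⟩
      exact ⟨hHU hxH, hSW n hxS⟩
  -- `lim U n` and `lim W n` cover the space, so their intersection has measure `μ(U) + μ(W) - 1`,
  -- at most the sum of the two errors.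
  have hbound : ∀ n : ℕ, (loebMeasure ω p).real {x | ¬ (x ∈ S ↔ x ∈ internalSet ω H)}
      ≤ 2 * (1 / ((n : ℝ) + 1)) := by
    intro n
    have h1 := measureReal_mono (μ := loebMeasure ω p) (hsub n)
    have h2 := measureReal_union_add_inter (μ := loebMeasure ω p) (s := internalSet ω (U n))
      (measurableSet_internalSet (W n))
    have h3 : internalSet ω (U n) ∪ internalSet ω (W n) = Set.univ :=
      Set.eq_univ_of_forall fun x => (em (x ∈ S)).imp (fun h => hSU n h) fun h => hSW n h
    rw [h3, probReal_univ] at h2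
    have h4 := probReal_compl_eq_one_sub (μ := loebMeasure ω p) hS
    linarith [hU n, hW n]
  have hlim : Tendsto (fun n : ℕ => 2 * (1 / ((n : ℝ) + 1))) atTop (nhds 0) := by
    simpa using (tendsto_one_div_add_atTop_nhds_zero_nat (𝕜 := ℝ)).const_mul 2
  have h0 := ge_of_tendsto' hlim hbound
  rw [ae_iff, ← measureReal_eq_zero_iff]
  exact le_antisymm h0 measureReal_nonneg

/-! ### Ultralimits of functions and their integrals -/

/-- `F` is the pointwise ultralimit of the functions `g_i`. -/
def IsPointwiseLimit (g : ∀ i, Vec p i → ℝ) (F : UltraSpace ω p → ℝ) : Prop :=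
  ∀ a : ∀ i, Vec p i, Tendsto (fun i => g i (a i)) (ω : Filter ℕ) (nhds (F (ulim ω a)))

theorem IsPointwiseLimit.measurable [NeZero p] {g : ∀ i, Vec p i → ℝ} {F : UltraSpace ω p → ℝ}
    (h : IsPointwiseLimit g F) : Measurable F := by
  refine measurable_of_Ioi fun c => ?_
  -- The margin `1 / (n + 1)` is needed because strict inequalities become weak ones in the limit.
  have : F ⁻¹' Set.Ioi c = ⋃ n : ℕ, internalSet ω fun i => {x | c + 1 / ((n : ℝ) + 1) < g i x} := by
    ext x
    obtain ⟨a, rfl⟩ := ulim_surjective x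
    simp only [Set.mem_preimage, Set.mem_Ioi, Set.mem_iUnion, ulim_mem_internalSet,
      Set.mem_ofPred_eq]
    constructor
    · intro hc
      obtain ⟨n, hn⟩ := exists_nat_one_div_lt (sub_pos.2 hc)
      exact ⟨n, (h a).eventually (lt_mem_nhds (by linarith))⟩
    · rintro ⟨n, hn⟩
      have h1 := ge_of_tendsto (h a) (hn.mono fun _ => le_of_lt)
      have : (0 : ℝ) < 1 / ((n : ℝ) + 1) := by positivity
      linarith
  rw [this]
  exact MeasurableSet.iUnion fun n => measurableSet_internalSet _

theorem isPointwiseLimit_indicator (H : ∀ i, Set (Vec p i)) :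
    IsPointwiseLimit (ω := ω) (fun i => (H i).indicator 1) ((internalSet ω H).indicator 1) := by
  intro a
  refine tendsto_const_nhds.congr' ?_
  by_cases h : ∀ᶠ i in (ω : Filter ℕ), a i ∈ H i
  · rw [Set.indicator_of_mem (ulim_mem_internalSet.2 h)]
    filter_upwards [h] with i hi
    simp [hi]
  · rw [Set.indicator_of_notMem (mt ulim_mem_internalSet.1 h)]
    filter_upwards [Ultrafilter.eventually_not.2 h] with i hi
    simp [hi]

theorem expect_indicator [NeZero p] {n : ℕ} (H : Set (Vec p n)) :
    𝔼 x, H.indicator (1 : Vec p n → ℝ) x = density H := by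
  classical
  rw [Fintype.expect_eq_sum_div_card, density, Nat.card_eq_fintype_card,
    Set.ncard_eq_toFinset_card', Finset.card_eq_sum_ones, Nat.cast_sum]
  congr 1
  rw [← Finset.sum_indicator_subset (fun _ => ((1 : ℕ) : ℝ)) (Finset.subset_univ H.toFinset)]
  simp [Set.indicator]

/-- The functions are rounded to multiples of `1 / (n + 1)`, uniformly in `i`. The resulting step
functions are combinations of indicators of internal sets, for which convergence is known. -/
theorem tendsto_expect_integral [NeZero p] (hω : ∀ s : Set ℕ, s.Finite → s ∉ ω)
    {g : ∀ i, Vec p i → ℝ} {F : UltraSpace ω p → ℝ} (h : IsPointwiseLimit g F)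
    (h0 : ∀ i x, 0 ≤ g i x) (h1 : ∀ i x, g i x ≤ 1) :
    Tendsto (fun i => 𝔼 x, g i x) (ω : Filter ℕ) (nhds (∫ x, F x ∂(loebMeasure ω p))) := by
  have := isProbabilityMeasure_loebMeasure (p := p) hω
  have hFm := h.measurable
  have hF0 : ∀ x, 0 ≤ F x := fun x => by
    obtain ⟨a, rfl⟩ := ulim_surjective x
    exact ge_of_tendsto' (h a) fun i => h0 i _
  have hF1 : ∀ x, F x ≤ 1 := fun x => by
    obtain ⟨a, rfl⟩ := ulim_surjective x
    exact le_of_tendsto' (h a) fun i => h1 i _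
  have hFint : Integrable F (loebMeasure ω p) :=
    Integrable.of_bound hFm.aestronglyMeasurable 1 (Eventually.of_forall fun x => by
      rw [Real.norm_of_nonneg (hF0 x)]; exact hF1 x)
  have hE : Tendsto (fun i => 𝔼 x, g i x) (ω : Filter ℕ)
      (nhds (st (hlim ω fun i => 𝔼 x, g i x))) :=
    tendsto_st_hlim (C := 1) (Eventually.of_forall fun i => by
      rw [abs_of_nonneg (Finset.expect_nonneg fun x _ => h0 i x)]
      exact Finset.expect_le Finset.univ_nonempty fun x _ => h1 i x)
  set e := st (hlim ω fun i => 𝔼 x, g i x)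
  suffices hb : ∀ n : ℕ, |(∫ x, F x ∂(loebMeasure ω p)) - e| ≤ 2 * (1 / ((n : ℝ) + 1)) by
    have hlim : Tendsto (fun n : ℕ => 2 * (1 / ((n : ℝ) + 1))) atTop (nhds 0) := by
      simpa using (tendsto_one_div_add_atTop_nhds_zero_nat (𝕜 := ℝ)).const_mul 2
    have := ge_of_tendsto' hlim hb
    rwa [sub_eq_zero.1 (abs_nonpos_iff.1 this)]
  intro n
  have hN : (0 : ℝ) < (n : ℝ) + 1 := by positivity
  -- Level sets of the rounded function. As `g ≤ 1`, the levels are `0, …, n + 1`, hence `range (n +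
  -- 2)`.
  let H : ℕ → ∀ i, Set (Vec p i) := fun j i => {x | ⌊((n : ℝ) + 1) * g i x⌋₊ = j}
  let c : ℕ → ℝ := fun j => (j : ℝ) / ((n : ℝ) + 1)
  let s : ∀ i, Vec p i → ℝ := fun i x =>
    ∑ j ∈ Finset.range (n + 2), c j * (H j i).indicator 1 x
  let FN : UltraSpace ω p → ℝ := fun x =>
    ∑ j ∈ Finset.range (n + 2), c j * (internalSet ω (H j)).indicator 1 x
  have hs : ∀ i x, |s i x - g i x| ≤ 1 / ((n : ℝ) + 1) := by
    intro i x
    have hfl : ⌊((n : ℝ) + 1) * g i x⌋₊ ∈ Finset.range (n + 2) := by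
      rw [Finset.mem_range, Nat.floor_lt (mul_nonneg hN.le (h0 i x))]
      push_cast
      nlinarith [h1 i x]
    have hsx : s i x = (⌊((n : ℝ) + 1) * g i x⌋₊ : ℝ) / ((n : ℝ) + 1) := by
      simp only [s]
      rw [Finset.sum_eq_single_of_mem _ hfl]
      · simp [H, c]
      · intro j _ hj
        simp [H, hj.symm]
    have hle := Nat.floor_le (mul_nonneg hN.le (h0 i x))
    have hlt := Nat.lt_floor_add_one (((n : ℝ) + 1) * g i x)
    have : s i x - g i x = (⌊((n : ℝ) + 1) * g i x⌋₊ - ((n : ℝ) + 1) * g i x) / ((n : ℝ) + 1) := by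
      rw [hsx]; field_simp
    rw [this, abs_div, abs_of_pos hN]
    gcongr
    rw [abs_le]
    constructor <;> linarith
  have hFN : ∀ x, |FN x - F x| ≤ 1 / ((n : ℝ) + 1) := by
    intro x
    obtain ⟨a, rfl⟩ := ulim_surjective x
    have hlim : Tendsto (fun i => s i (a i)) (ω : Filter ℕ) (nhds (FN (ulim ω a))) :=
      tendsto_finsetSum _ fun j _ => (isPointwiseLimit_indicator (H j) a).const_mul _
    exact le_of_tendsto' (hlim.sub (h a)).abs fun i => hs i _
  have hterm : ∀ j, Integrable (fun x => c j * (internalSet ω (H j)).indicator (1 : UltraSpace ω p → ℝ) x)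
      (loebMeasure ω p) := fun j =>
    ((integrable_const (1 : ℝ)).indicator (measurableSet_internalSet (H j))).const_mul _
  have hFNint : Integrable FN (loebMeasure ω p) := integrable_finsetSum _ fun j _ => hterm j
  have hI : ∫ x, FN x ∂(loebMeasure ω p)
      = ∑ j ∈ Finset.range (n + 2), c j * (internalMass ω (H j)).toReal := by
    simp only [FN]
    rw [integral_finsetSum _ fun j _ => hterm j]
    refine Finset.sum_congr rfl fun j _ => ?_
    rw [integral_const_mul, integral_indicator_one (measurableSet_internalSet (H j)),
      measureReal_def, loebMeasure_internalSet hω]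
  have hEs : Tendsto (fun i => 𝔼 x, s i x) (ω : Filter ℕ)
      (nhds (∫ x, FN x ∂(loebMeasure ω p))) := by
    rw [hI]
    have : ∀ i, 𝔼 x, s i x = ∑ j ∈ Finset.range (n + 2), c j * density (H j i) := by
      intro i
      simp only [s]
      rw [Finset.expect_sum_comm]
      simp only [← Finset.mul_expect, expect_indicator]
    simp only [this]
    exact tendsto_finsetSum _ fun j _ => (tendsto_density (H j)).const_mul _
  have hd1 : |(∫ x, FN x ∂(loebMeasure ω p)) - e| ≤ 1 / ((n : ℝ) + 1) := by
    refine le_of_tendsto' (hEs.sub hE).abs fun i => ?_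
    rw [← Finset.expect_sub_distrib]
    exact (Finset.abs_expect_le _ _).trans
      (Finset.expect_le Finset.univ_nonempty fun x _ => hs i x)
  have hd2 : |(∫ x, FN x ∂(loebMeasure ω p)) - ∫ x, F x ∂(loebMeasure ω p)|
      ≤ 1 / ((n : ℝ) + 1) := by
    rw [← integral_sub hFNint hFint]
    simpa using norm_integral_le_of_norm_le_const (μ := loebMeasure ω p)
      (f := fun x => FN x - F x) (Eventually.of_forall hFN)
  rw [abs_le] at *
  constructor <;> linarith

/-! ### Iterated integrals and averages over linear forms -/

theorem expect_snoc {V : Type*} [Fintype V] (k : ℕ) (g : (Fin (k + 1) → V) → ℝ) :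
    𝔼 x, g x = 𝔼 y, 𝔼 x : Fin k → V, g (Fin.snoc (α := fun _ => V) x y) := by
  rw [← Finset.expect_product' Finset.univ Finset.univ
    fun y (x : Fin k → V) => g (Fin.snoc (α := fun _ => V) x y), Finset.univ_product_univ]
  exact (Fintype.expect_equiv (Fin.snocEquiv fun _ => V) _ _ fun _ => rfl).symm

/-- By induction the inner averages converge pointwise in the last variable, so the one-variable
case applies to them. No product measure or joint measurability enters. -/
theorem tendsto_expect_iterInt [NeZero p] (hω : ∀ s : Set ℕ, s.Finite → s ∉ ω) (k : ℕ)
    (g : ∀ i, (Fin k → Vec p i) → ℝ) (G : (Fin k → UltraSpace ω p) → ℝ)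
    (h0 : ∀ i x, 0 ≤ g i x) (h1 : ∀ i x, g i x ≤ 1)
    (h : ∀ a : Fin k → ∀ i, Vec p i, Tendsto (fun i => g i fun j => a j i) (ω : Filter ℕ)
      (nhds (G fun j => ulim ω (a j)))) :
    Tendsto (fun i => 𝔼 x, g i x) (ω : Filter ℕ) (nhds (iterInt ω p k G)) := by
  induction k with
  | zero =>
    have h2 := h Fin.elim0
    simp only [iterInt]
    convert! h2 using 2 with i
    · rw [Fintype.expect_eq_sum_div_card]
      simp
      congr 1
      exact Subsingleton.elim _ _
    · congr 1
      exact Subsingleton.elim _ _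
  | succ k ih =>
    simp only [iterInt, expect_snoc]
    refine tendsto_expect_integral hω (fun b => ?_)
      (fun i y => Finset.expect_nonneg fun x _ => h0 i _)
      (fun i y => Finset.expect_le Finset.univ_nonempty fun x _ => h1 i _)
    refine ih (fun i x => g i (Fin.snoc (α := fun _ => Vec p i) x (b i))) _ (fun _ _ => h0 _ _)
      (fun _ _ => h1 _ _) fun a => ?_
    convert! h (Fin.snoc (α := fun _ => ∀ i, Vec p i) a b) using 2 with i
    · congr 1
      ext1 j
      refine Fin.lastCases ?_ (fun j => ?_) j <;> simp
    · congr 1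
      ext1 j
      refine Fin.lastCases ?_ (fun j => ?_) j <;> simp

/-- `iterInt` splits off the last variable first, so variable 0 is integrated innermost. -/
theorem iterInt_congr (k : ℕ) {G G' : (Fin (k + 1) → UltraSpace ω p) → ℝ}
    (h : ∀ z : Fin k → UltraSpace ω p,
      ∫ y, G (Fin.cons (α := fun _ => UltraSpace ω p) y z) ∂(loebMeasure ω p)
        = ∫ y, G' (Fin.cons (α := fun _ => UltraSpace ω p) y z) ∂(loebMeasure ω p)) :
    iterInt ω p (k + 1) G = iterInt ω p (k + 1) G' := by
  induction k with
  | zero =>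
    have hs : ∀ y : UltraSpace ω p, Fin.snoc (α := fun _ => UltraSpace ω p) Fin.elim0 y
        = Fin.cons (α := fun _ => UltraSpace ω p) y Fin.elim0 := fun y => by
      ext1 j
      rw [Fin.fin_one_eq_zero j]
      rfl
    simpa only [iterInt, hs] using h Fin.elim0
  | succ k ih =>
    rw [iterInt, iterInt]
    congr 1
    ext1 y
    refine ih fun z => ?_
    simpa only [Fin.cons_snoc_eq_snoc_cons] using h (Fin.snoc (α := fun _ => UltraSpace ω p) z y)

/-- Affinity is essential: with the other variables fixed, each form is a translation in the first
variable, so it pulls null sets back to null sets. The zero form would see a single value of `f`. -/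
theorem tLim_congr_ae {k : ℕ} {𝓛 : Finset (Vec p (k + 1))} (h𝓛 : IsAffineSystem 𝓛)
    {f h : UltraSpace ω p → ℝ} (hfh : f =ᵐ[loebMeasure ω p] h) : tLim 𝓛 f = tLim 𝓛 h := by
  refine iterInt_congr k fun z => integral_congr_ae ?_
  have key : ∀ L ∈ 𝓛, ∀ y : UltraSpace ω p,
      evalForm L (Fin.cons (α := fun _ => UltraSpace ω p) y z)
        = y + ∑ j : Fin k, L j.succ • z j := fun L hL y => by
    simp [evalForm, Fin.sum_univ_succ, h𝓛 L hL]
  have hall : ∀ᵐ y ∂(loebMeasure ω p), ∀ L ∈ 𝓛,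
      f (y + ∑ j : Fin k, L j.succ • z j) = h (y + ∑ j : Fin k, L j.succ • z j) :=
    (Finset.eventually_all 𝓛).2 fun L _ => ae_add_right hfh _
  filter_upwards [hall] with y hy
  exact Finset.prod_congr rfl fun L hL => by rw [key L hL, hy L hL]

theorem evalForm_ulim {k : ℕ} (L : Vec p k) (a : Fin k → ∀ i, Vec p i) :
    evalForm L (fun j => ulim ω (a j)) = ulim ω fun i => evalForm L fun j => a j i := by
  have h : ∀ x, ulim ω x = ulimHom ω p x := fun _ => rfl
  simp only [evalForm, ← ulim_smul]
  simp only [h]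
  rw [← map_sum]
  congr 1
  ext1 i
  simp

/-- Averages over the finite spaces converge to the averages of the ultralimit. -/
theorem IsPointwiseLimit.tendsto_tFun [NeZero p] (hω : ∀ s : Set ℕ, s.Finite → s ∉ ω)
    {g : ∀ i, Vec p i → ℝ} {F : UltraSpace ω p → ℝ} (h : IsPointwiseLimit g F)
    (h0 : ∀ i x, 0 ≤ g i x) (h1 : ∀ i x, g i x ≤ 1) {k : ℕ} (𝓛 : Finset (Vec p k)) :
    Tendsto (fun i => tFun 𝓛 (g i)) (ω : Filter ℕ) (nhds (tLim 𝓛 F)) := by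
  refine tendsto_expect_iterInt hω k _ _ (fun i x => Finset.prod_nonneg fun L _ => h0 i _)
    (fun i x => Finset.prod_le_one (fun L _ => h0 i _) fun L _ => h1 i _) fun a => ?_
  refine tendsto_finsetProd _ fun L _ => ?_
  rw [evalForm_ulim]
  exact h _

/-! ### Reduction to an internal set and choice of the sequence -/

/-- A `{0,1}`-valued function that is measurable or a function limit agrees almost everywhere with
the indicator function of an internal set. -/
theorem exists_ae_eq_indicator_internalSet [NeZero p] (hω : ∀ s : Set ℕ, s.Finite → s ∉ ω)
    {f : UltraSpace ω p → ℝ} (hf : Measurable f ∨ IsFunctionLimit f)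
    (hf01 : ∀ x, f x = 0 ∨ f x = 1) :
    Measurable f ∧ ∃ H, f =ᵐ[loebMeasure ω p] (internalSet ω H).indicator 1 := by
  classical
  rcases hf with hf | ⟨g, hg⟩
  · obtain ⟨H, hH⟩ := exists_internalSet_ae_eq hω (hf (measurableSet_singleton 1))
    refine ⟨hf, H, ?_⟩
    filter_upwards [hH] with x hx
    simp only [Set.mem_preimage, Set.mem_singleton_iff] at hx
    rcases hf01 x with h | h
    · rw [Set.indicator_of_notMem (by rw [← hx, h]; exact zero_ne_one), h]
    · rw [Set.indicator_of_mem (hx.1 h), h, Pi.one_apply]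
  · have hlim : IsPointwiseLimit g f := fun a => by
      rw [(hg a).2]
      exact (hg a).1.tendsto
    -- The limit is 0 or 1, so any threshold strictly between them decides it; equality holds
    -- everywhere here.
    refine ⟨hlim.measurable, fun i => {x | 1 / 2 < g i x}, Eventually.of_forall fun x => ?_⟩
    obtain ⟨a, rfl⟩ := ulim_surjective x
    rcases hf01 (ulim ω a) with h | h
    · rw [Set.indicator_of_notMem, h]
      rw [ulim_mem_internalSet]
      intro hc
      obtain ⟨i, h1, h2⟩ := (hc.and ((hlim a).eventually
        (gt_mem_nhds (show f (ulim ω a) < 1 / 2 by rw [h]; norm_num)))).exists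
      exact lt_asymm h1 h2
    · rw [Set.indicator_of_mem, h, Pi.one_apply]
      exact ulim_mem_internalSet.2 ((hlim a).eventually 
        (lt_mem_nhds (show 1 / 2 < f (ulim ω a) by rw [h]; norm_num)))

/-- If countably many sequences converge along `ω`, some subsequence of positive indices makes
all of them converge. -/
theorem exists_subseq_tendsto (hω : ∀ s : Set ℕ, s.Finite → s ∉ ω) {ι : Type*} [Countable ι]
    [Nonempty ι] (t : ι → ℕ → ℝ) (l : ι → ℝ)
    (h : ∀ m, Tendsto (t m) (ω : Filter ℕ) (nhds (l m))) :
    ∃ n : ℕ → ℕ, (∀ j, 1 ≤ n j) ∧ ∀ m, Tendsto (fun j => t m (n j)) atTop (nhds (l m)) := by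
  obtain ⟨e, he⟩ := exists_surjective_nat ι
  have hpos : ∀ᶠ i in (ω : Filter ℕ), 1 ≤ i := by
    filter_upwards [Ultrafilter.compl_mem_iff_notMem.2 (hω {0} (Set.finite_singleton 0))] with i hi
    exact Nat.one_le_iff_ne_zero.2 hi
  -- The `j`-th index serves the first `j + 1` sequences to within `1 / (j + 1)`; finitely many
  -- `ω`-large sets have a common element. The indices need not increase.
  have key : ∀ j : ℕ, ∃ i, 1 ≤ i ∧ ∀ m ∈ Finset.range (j + 1),
      dist (t (e m) i) (l (e m)) < 1 / ((j : ℝ) + 1) := fun j =>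
    (hpos.and ((Finset.eventually_all _).2 fun m _ =>
      (h (e m)).eventually (Metric.ball_mem_nhds _ (by positivity)))).exists
  choose n hn1 hn using key
  refine ⟨n, hn1, fun m => ?_⟩
  obtain ⟨m, rfl⟩ := he m
  rw [tendsto_iff_dist_tendsto_zero]
  refine squeeze_zero' (Eventually.of_forall fun _ => dist_nonneg) ?_
    (tendsto_one_div_add_atTop_nhds_zero_nat (𝕜 := ℝ))
  filter_upwards [eventually_ge_atTop m] with j hj
  exact (hn j m (Finset.mem_range.2 (Nat.lt_succ_of_le hj))).le

end UltraLimit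

theorem mainTheorem6 (p : ℕ) [Fact p.Prime] (ω : Ultrafilter ℕ)
    (hω : ∀ s : Set ℕ, s.Finite → s ∉ ω)
    (f : UltraSpace ω p → ℝ)
    (hf : Measurable f ∨ IsFunctionLimit f)
    (hf01 : ∀ x, f x = 0 ∨ f x = 1) :
    ∃ (n : ℕ → ℕ) (g : ∀ j : ℕ, Vec p (n j) → ℝ),
      (∀ j, 1 ≤ n j) ∧ (∀ j x, g j x = 0 ∨ g j x = 1) ∧ TConvergesTo g f := by
  classical
  obtain ⟨hfm, H, hH⟩ := exists_ae_eq_indicator_internalSet hω hf hf01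
  have h01 : ∀ i x, (H i).indicator (1 : Vec p i → ℝ) x = 0 ∨
      (H i).indicator (1 : Vec p i → ℝ) x = 1 := fun i x => by
    by_cases hx : x ∈ H i <;> simp [hx]
  -- Affine systems in all numbers of variables form one countable index type; the empty system
  -- shows that it is nonempty.
  have : Nonempty (Σ k, {𝓛 : Finset (Vec p (k + 1)) // IsAffineSystem 𝓛}) :=
    ⟨⟨0, ∅, by simp [IsAffineSystem]⟩⟩
  obtain ⟨n, hn1, hn⟩ := exists_subseq_tendsto hω
    (ι := Σ k, {𝓛 : Finset (Vec p (k + 1)) // IsAffineSystem 𝓛})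
    (fun m i => tFun m.2.1 ((H i).indicator 1)) (fun m => tLim m.2.1 f) fun m => by
      rw [tLim_congr_ae m.2.2 hH]
      exact (isPointwiseLimit_indicator H).tendsto_tFun hω
        (fun i x => by rcases h01 i x with h | h <;> simp [h])
        (fun i x => by rcases h01 i x with h | h <;> simp [h]) _
  refine ⟨n, fun j => (H (n j)).indicator 1, hn1, fun j x => h01 _ x, ⟨hfm, 1, fun x => ?_⟩,
    fun k 𝓛 h𝓛 => hn ⟨k, 𝓛, h𝓛⟩⟩
  rcases hf01 x with h | h <;> simp [h]
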